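/- An \emph{MV-algebra} is a structure $\mathbf A=\langle A,\oplus,\neg,0\rangle$ such that $\langle A,\oplus,0\rangle$ is a commutative monoid and, with $1:=\neg 0$, $\neg\neg x=x$, $x\oplus 1=1$ and $\neg(\neg x\oplus y)\oplus y=\neg(\neg y\oplus x)\oplus x$. Put $x\to y:=\neg x\oplus y$, $x*y:=\neg(\neg x\oplus\neg y)$; the relation $x\le y$ iff $x\to y=1$ is a bounded lattice order on $A$, with operations $\vee,\wedge$ and bounds $0,1$. A \emph{monadic MV-algebra} $\langle\mathbf A,\exists,\forall\rangle$ is an MV-algebra with two unary operations satisfying $\forall x\to x=1$, $\forall(x\to\forall y)=\exists x\to\forall y$, $\forall(\forall x\to y)=\forall x\to\forall y$, $\forall(\exists x\vee y)=\exists x\vee\forall y$ and $\exists(x*x)=\exists x*\exists x$. It is \emph{finitely subdirectly irreducible} (FSI) if its identity congruence is not the intersection of two congruences both different from the identity. For a natural number $k$ let $(W_k)$ be the identity $$\bigwedge_{1\le i<j\le k+1}\forall(x_i\vee x_j)\ \to\ \bigvee_{i=1}^{k+1}\forall x_i\ \approx\ 1 ;$$ for $k\ge 1$, the algebra has \emph{width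 $k$} if it satisfies $(W_k)$ but not $(W_{k-1})$. For a totally ordered MV-algebra $\mathbf V$, $\langle\mathbf V^k,\exists_\vee,\forall_\wedge\rangle$ is the monadic MV-algebra of $k$-tuples with pointwise MV-operations, where $\exists_\vee(f)$ and $\forall_\wedge(f)$ are the constant tuples with value $\max_i f(i)$ and $\min_i f(i)$ respectively. \textbf{Theorem.} Let $k\ge 1$ and let $\langle\mathbf A,\exists,\forall\rangle$ be a finitely subdirectly irreducible monadic MV-algebra of width $k$. Then there are a totally ordered MV-algebra $\mathbf V$ and an embedding (injective homomorphism of monadic MV-algebras) $\alpha\colon\langle\mathbf A,\exists,\forall\rangle\to\langle\mathbf V^k,\exists_\vee,\forall_\wedge\rangle$. -/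

import Mathlib

universe u

/-- An MV-algebra `⟨A, ⊕, ¬, 0⟩`, with `⊕` written `+` and `¬` written `ᶜ`.
The unit `1` of the algebra is `0ᶜ`. -/
class MVAlgebra (A : Type*) extends AddCommMonoid A, Compl A where
  compl_compl' : ∀ x : A, xᶜᶜ = x
  add_one' : ∀ x : A, x + 0ᶜ = 0ᶜ
  sup_comm' : ∀ x y : A, (xᶜ + y)ᶜ + y = (yᶜ + x)ᶜ + x

namespace MVAlgebra

variable {A : Type*} [MVAlgebra A]

/-- The implication `x → y`. -/
def imp (x y : A) : A := xᶜ + y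

/-- The product (strong conjunction) `x * y`. -/
def prod (x y : A) : A := (xᶜ + yᶜ)ᶜ

/-- The natural order: `x ≤ y` iff `x → y = 1`. -/
instance (priority := low) : LE A := ⟨fun x y => imp x y = 0ᶜ⟩

theorem le_iff {x y : A} : x ≤ y ↔ xᶜ + y = 0ᶜ := Iff.rfl

theorem compl_add_self (y : A) : yᶜ + y = 0ᶜ := by
  have h := sup_comm' (0ᶜ : A) y
  rwa [compl_compl', zero_add, add_one'] at h

theorem le_iff_exists {x y : A} : x ≤ y ↔ ∃ z, x + z = y := by
  constructor
  · intro h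
    have h1 := sup_comm' x y
    rw [le_iff.1 h, compl_compl', zero_add] at h1
    exact ⟨(yᶜ + x)ᶜ, by rw [add_comm]; exact h1.symm⟩
  · rintro ⟨z, rfl⟩
    rw [le_iff, ← add_assoc, compl_add_self, add_comm, add_one']

theorem compl_anti {x y : A} (h : x ≤ y) : yᶜ ≤ xᶜ := by
  rw [le_iff, compl_compl', add_comm]; exact h

theorem add_mono_right {x y : A} (h : x ≤ y) (z : A) : x + z ≤ y + z := by
  obtain ⟨w, rfl⟩ := le_iff_exists.1 h
  exact le_iff_exists.2 ⟨w, by rw [add_right_comm]⟩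

/-- The partial order of an MV-algebra. -/
instance (priority := low) instPartialOrder : PartialOrder A where
  le_refl := compl_add_self
  le_trans x y z h1 h2 := by
    obtain ⟨u, rfl⟩ := le_iff_exists.1 h1
    obtain ⟨v, rfl⟩ := le_iff_exists.1 h2
    exact le_iff_exists.2 ⟨u + v, by rw [add_assoc]⟩
  le_antisymm x y h1 h2 := by
    have h := sup_comm' x y
    rw [le_iff.1 h1, le_iff.1 h2, compl_compl', zero_add, zero_add] at h
    exact h.symm

theorem join_le {x y z : A} (h1 : x ≤ z) (h2 : y ≤ z) : (xᶜ + y)ᶜ + y ≤ z := by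
  have h3 := sup_comm' y z
  rw [le_iff.1 h2, compl_compl', zero_add] at h3
  calc (xᶜ + y)ᶜ + y ≤ (zᶜ + y)ᶜ + y :=
        add_mono_right (compl_anti (add_mono_right (compl_anti h1) y)) y
    _ = z := h3.symm

theorem le_join_right (x y : A) : y ≤ (xᶜ + y)ᶜ + y :=
  le_iff_exists.2 ⟨_, add_comm _ _⟩

theorem le_join_left (x y : A) : x ≤ (xᶜ + y)ᶜ + y := by
  rw [sup_comm']; exact le_join_right y x

/-- The lattice operations `x ∨ y = (x → y) → y` and `x ∧ y = ¬(¬x ∨ ¬y)`. -/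
instance (priority := low) instLattice : Lattice A where
  sup x y := (xᶜ + y)ᶜ + y
  inf x y := ((xᶜᶜ + yᶜ)ᶜ + yᶜ)ᶜ
  le_sup_left := le_join_left
  le_sup_right := le_join_right
  sup_le _ _ _ := join_le
  inf_le_left x y := by
    have h := compl_anti (le_join_left xᶜ yᶜ)
    rwa [compl_compl' x] at h ⊢
  inf_le_right x y := by
    have h := compl_anti (le_join_right xᶜ yᶜ)
    rwa [compl_compl' y] at h
  le_inf x y z h1 h2 := by
    have h := compl_anti (join_le (compl_anti h1) (compl_anti h2))
    rwa [compl_compl' x] at h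

/-- The bounds of an MV-algebra: `⊥ = 0` and `⊤ = 1 = ¬0`. -/
instance (priority := low) instBoundedOrder : BoundedOrder A where
  top := 0ᶜ
  bot := 0
  le_top x := by rw [le_iff, add_one']
  bot_le x := le_iff_exists.2 ⟨x, zero_add x⟩

/-- The power `A^X` with the pointwise operations. -/
instance instPi {X : Type*} : MVAlgebra (X → A) where
  compl_compl' f := funext fun x => compl_compl' (f x)
  add_one' f := funext fun x => add_one' (f x)
  sup_comm' f g := funext fun x => sup_comm' (f x) (g x)

end MVAlgebra

/-- A totally ordered MV-algebra. -/
class MVChain (V : Type*) extends MVAlgebra V where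
  le_total' : ∀ x y : V, x ≤ y ∨ y ≤ x

open MVAlgebra in
/-- A monadic MV-algebra `⟨A, ∃, ∀⟩`, with `∃` written `ex` and `∀` written `all`. -/
class MonadicMVAlgebra (A : Type*) extends MVAlgebra A where
  ex : A → A
  all : A → A
  m1 : ∀ x : A, imp (all x) x = 0ᶜ
  m2 : ∀ x y : A, all (imp x (all y)) = imp (ex x) (all y)
  m3 : ∀ x y : A, all (imp (all x) y) = imp (all x) (all y)
  m4 : ∀ x y : A, all (ex x ⊔ y) = ex x ⊔ all y
  m5 : ∀ x : A, ex (prod x x) = prod (ex x) (ex x)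

/-- Congruences of a monadic MV-algebra. -/
structure MonadicMVCongruence (A : Type*) [MonadicMVAlgebra A] extends Setoid A where
  add' : ∀ {a b c d : A}, r a b → r c d → r (a + c) (b + d)
  compl' : ∀ {a b : A}, r a b → r aᶜ bᶜ
  ex' : ∀ {a b : A}, r a b → r (MonadicMVAlgebra.ex a) (MonadicMVAlgebra.ex b)
  all' : ∀ {a b : A}, r a b → r (MonadicMVAlgebra.all a) (MonadicMVAlgebra.all b)

/-- An injective homomorphism of monadic MV-algebras. -/
structure MonadicMVEmbedding (A B : Type*) [MonadicMVAlgebra A] [MonadicMVAlgebra B] where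
  toFun : A → B
  injective' : Function.Injective toFun
  map_zero' : toFun 0 = 0
  map_add' : ∀ a b : A, toFun (a + b) = toFun a + toFun b
  map_compl' : ∀ a : A, toFun aᶜ = (toFun a)ᶜ
  map_ex' : ∀ a : A, toFun (MonadicMVAlgebra.ex a) = MonadicMVAlgebra.ex (toFun a)
  map_all' : ∀ a : A, toFun (MonadicMVAlgebra.all a) = MonadicMVAlgebra.all (toFun a)

namespace MonadicMVAlgebra

open MVAlgebra

section width

variable (A : Type*) [MonadicMVAlgebra A]

/-- Finitely subdirectly irreducible: the identity congruence is not the intersection of two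
congruences that are both different from it. -/
def IsFSI : Prop :=
  ∀ θ φ : MonadicMVCongruence A, (∀ a b : A, θ.r a b ∧ φ.r a b → a = b) →
    (∀ a b : A, θ.r a b → a = b) ∨ (∀ a b : A, φ.r a b → a = b)

/-- The identity `(W_k)`:
`⋀_{1 ≤ i < j ≤ k+1} ∀(x_i ∨ x_j) → ⋁_{i=1}^{k+1} ∀ x_i ≈ 1`. -/
def SatisfiesW (k : ℕ) : Prop :=
  ∀ x : Fin (k + 1) → A,
    imp ((Finset.univ.filter fun p : Fin (k + 1) × Fin (k + 1) => p.1 < p.2).inf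
        fun p => all (x p.1 ⊔ x p.2))
      (Finset.univ.sup fun i => all (x i)) = 0ᶜ

/-- Width `k`, for `k ≥ 1`: `(W_k)` holds and `(W_{k-1})` fails. -/
def HasWidth (k : ℕ) : Prop := SatisfiesW A k ∧ ¬ SatisfiesW A (k - 1)

end width

section power

variable {X V : Type*} [Fintype X]

/-- `∃_∨ f` is the constant function with value the join of the values of `f`. -/
def existsSup [MVAlgebra V] (f : X → V) : X → V := fun _ => Finset.univ.sup f

/-- `∀_∧ f` is the constant function with value the meet of the values of `f`. -/
def forallInf [MVAlgebra V] (f : X → V) : X → V := fun _ => Finset.univ.inf f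

theorem existsSup_attained [MVChain V] (f : X → V) (x : X) :
    ∃ x₀, (∀ y, f y ≤ f x₀) ∧ ∀ z, existsSup f z = f x₀ := by
  obtain ⟨x₀, hx₀⟩ := (Set.finite_univ (α := X)).exists_maximalFor f _ ⟨x, trivial⟩
  have h : ∀ y, f y ≤ f x₀ := fun y =>
    (MVChain.le_total' (f y) (f x₀)).elim id fun h => hx₀.2 trivial h
  exact ⟨x₀, h, fun _ => le_antisymm (Finset.sup_le fun y _ => h y)
    (Finset.le_sup (f := f) (Finset.mem_univ x₀))⟩

theorem forallInf_attained [MVChain V] (f : X → V) (x : X) :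
    ∃ x₀, (∀ y, f x₀ ≤ f y) ∧ ∀ z, forallInf f z = f x₀ := by
  obtain ⟨x₀, hx₀⟩ := (Set.finite_univ (α := X)).exists_minimalFor f _ ⟨x, trivial⟩
  have h : ∀ y, f x₀ ≤ f y := fun y =>
    (MVChain.le_total' (f x₀) (f y)).elim id fun h => hx₀.2 trivial h
  exact ⟨x₀, h, fun _ => le_antisymm (Finset.inf_le (f := f) (Finset.mem_univ x₀))
    (Finset.le_inf fun y _ => h y)⟩

theorem existsSup_eq [MVChain V] {f : X → V} {x₀ : X} (h : ∀ y, f y ≤ f x₀) (z : X) :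
    existsSup f z = f x₀ :=
  le_antisymm (Finset.sup_le fun y _ => h y) (Finset.le_sup (f := f) (Finset.mem_univ x₀))

theorem forallInf_eq [MVChain V] {f : X → V} {x₀ : X} (h : ∀ y, f x₀ ≤ f y) (z : X) :
    forallInf f z = f x₀ :=
  le_antisymm (Finset.inf_le (f := f) (Finset.mem_univ x₀)) (Finset.le_inf fun y _ => h y)

/-- The algebra `⟨V^X, ∃_∨, ∀_∧⟩` for a totally ordered MV-algebra `V` and a finite set `X`. -/
instance instPower [MVChain V] : MonadicMVAlgebra (X → V) where
  ex := existsSup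
  all := forallInf
  m1 f := funext fun x => by
    show forallInf f x ≤ f x
    exact Finset.inf_le (f := f) (Finset.mem_univ x)
  m2 f g := funext fun x => by
    obtain ⟨x₀, h, e⟩ := existsSup_attained f x
    obtain ⟨x₁, -, e'⟩ := forallInf_attained g x
    rw [forallInf_eq (x₀ := x₀)]
    · show (f x₀)ᶜ + forallInf g x₀ = (existsSup f x)ᶜ + forallInf g x
      rw [e, e', e']
    · intro y
      show (f x₀)ᶜ + forallInf g x₀ ≤ (f y)ᶜ + forallInf g y
      rw [e', e']
      exact add_mono_right (compl_anti (h y)) _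
  m3 f g := funext fun x => by
    obtain ⟨x₀, h, e⟩ := forallInf_attained g x
    obtain ⟨x₁, -, e'⟩ := forallInf_attained f x
    rw [forallInf_eq (x₀ := x₀)]
    · show (forallInf f x₀)ᶜ + g x₀ = (forallInf f x)ᶜ + forallInf g x
      rw [e, e', e']
    · intro y
      show (forallInf f x₀)ᶜ + g x₀ ≤ (forallInf f y)ᶜ + g y
      rw [e', e', add_comm, add_comm _ (g y)]
      exact add_mono_right (h y) _
  m4 f g := funext fun x => by
    obtain ⟨x₀, h, e⟩ := forallInf_attained g x
    obtain ⟨x₁, -, e'⟩ := existsSup_attained f x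
    rw [forallInf_eq (x₀ := x₀)]
    · show existsSup f x₀ ⊔ g x₀ = existsSup f x ⊔ forallInf g x
      rw [e, e', e']
    · intro y
      show existsSup f x₀ ⊔ g x₀ ≤ existsSup f y ⊔ g y
      rw [e', e']
      exact sup_le_sup_left (h y) _
  m5 f := funext fun x => by
    obtain ⟨x₀, h, e⟩ := existsSup_attained f x
    rw [existsSup_eq (x₀ := x₀)]
    · show ((f x₀)ᶜ + (f x₀)ᶜ)ᶜ = ((existsSup f x)ᶜ + (existsSup f x)ᶜ)ᶜ
      rw [e]
    · intro y
      show ((f y)ᶜ + (f y)ᶜ)ᶜ ≤ ((f x₀)ᶜ + (f x₀)ᶜ)ᶜ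
      have h1 := compl_anti (h y)
      refine compl_anti (le_trans (add_mono_right h1 _) ?_)
      rw [add_comm]
      exact add_mono_right h1 _

end power

end MonadicMVAlgebra

/-!
Call an ideal of `A` null if `∀` vanishes on it. In a finitely subdirectly irreducible algebra the
constants form a chain `C`, and this makes every maximal null ideal prime, so that its quotient is a
totally ordered MV-algebra in which `C` embeds. Incomparable primes are separated by pairwise
disjoint elements, whose complements would violate `(W_k)` if there were `k + 1` maximal null
ideals; so there are at most `k`.

These quotients are amalgamated over `C` in one totally ordered MV-algebra `V`. Chang's construction
turns them into totally ordered abelian groups with strong unit. In the product of these groups, no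
element of the subgroup of identifications over `C` is positive. Hence some submonoid contains what
lies above an identification and avoids what lies strictly below one; a maximal such submonoid is
the nonnegative cone of a total order on a quotient of the product, and each factor embeds in it.

The homomorphism `A → V ^ k` so obtained preserves `∀` because `x - ∀ x` is null: it lies in some
maximal null ideal, so the coordinates of `x` attain the constant value `∀ x`. For the same reason
`∃` is preserved, and a nonzero element `x` is not killed, because `∃ x` is a nonzero constant.
-/

universe v

namespace MVAlgebra

section Arithmetic

variable {A : Type*} [MVAlgebra A]

/-- Truncated difference: `x - y` is the least `z` with `x ≤ z + y`. -/
instance (priority := low) instSub : Sub A := ⟨fun x y => (xᶜ + y)ᶜ⟩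

theorem sub_def (x y : A) : x - y = (xᶜ + y)ᶜ := rfl

instance (priority := low) instIsOrderedAddMonoid : IsOrderedAddMonoid A where
  add_le_add_left _ _ h c := add_mono_right h c

instance (priority := low) instOrderedSub : OrderedSub A where
  tsub_le_iff_right x y z := by
    rw [le_iff, le_iff, sub_def, compl_compl', add_assoc, add_comm y z]

instance (priority := low) instCanonicallyOrderedAdd : CanonicallyOrderedAdd A where
  exists_add_of_le h := (le_iff_exists.1 h).imp fun _ hz => hz.symm
  le_self_add _ y := le_iff_exists.2 ⟨y, rfl⟩
  le_add_self _ y := le_iff_exists.2 ⟨y, add_comm _ _⟩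

theorem le_compl_zero (x : A) : x ≤ 0ᶜ := le_top

theorem compl_zero_le_iff {x : A} : 0ᶜ ≤ x ↔ x = 0ᶜ := top_le_iff

theorem compl_injective : Function.Injective (compl : A → A) :=
  Function.Involutive.injective compl_compl'

theorem compl_le_iff_add_eq {x y : A} : xᶜ ≤ y ↔ x + y = 0ᶜ := by
  rw [le_iff, compl_compl']

theorem compl_le_compl_add_iff {x y e : A} : yᶜ ≤ xᶜ + e ↔ x ≤ y + e := by
  rw [le_iff, le_iff, compl_compl', add_left_comm]

theorem sub_le_compl (x y : A) : x - y ≤ yᶜ := compl_anti le_add_self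

theorem zero_ne_compl_zero [Nontrivial A] : (0 : A) ≠ 0ᶜ := fun h => by
  obtain ⟨x, hx⟩ := exists_ne (0 : A)
  exact hx (le_antisymm (h ▸ le_compl_zero x) zero_le)

theorem add_sub_cancel_of_le_compl {x y : A} (h : x ≤ yᶜ) : x + y - y = x := by
  have hsup := sup_comm' xᶜ y
  rw [compl_compl', add_comm yᶜ, le_iff.1 h, compl_compl', zero_add] at hsup
  rw [sub_def, hsup, compl_compl']

theorem add_inf_eq (a b c : A) : a + b ⊓ c = (a + b) ⊓ (a + c) := by
  refine le_antisymm (le_inf (add_le_add_right inf_le_left a) (add_le_add_right inf_le_right a)) ?_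
  rw [← tsub_le_iff_left]
  exact le_inf (tsub_le_iff_left.2 inf_le_left) (tsub_le_iff_left.2 inf_le_right)

theorem le_inf_add_sub (x y : A) : x ≤ x ⊓ y + (x - y) := by
  rw [add_comm, add_inf_eq]
  exact le_inf le_add_self le_tsub_add

theorem inf_add_le (x y z : A) : x ⊓ (y + z) ≤ x ⊓ y + x ⊓ z := by
  rw [add_inf_eq (x ⊓ y) x z, add_comm (x ⊓ y) x, add_comm (x ⊓ y) z, add_inf_eq x x y,
    add_inf_eq z x y, add_comm z y]
  exact le_inf (le_inf (inf_le_left.trans le_self_add) (inf_le_left.trans le_self_add))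
    (le_inf (inf_le_left.trans le_add_self) inf_le_right)

theorem inf_nsmul_eq_zero {x y : A} (h : x ⊓ y = 0) (n : ℕ) : x ⊓ n • y = 0 := by
  induction n with
  | zero => rw [zero_nsmul, inf_eq_right.2 zero_le]
  | succ n ih =>
    rw [succ_nsmul, ← nonpos_iff_eq_zero]
    exact (inf_add_le _ _ _).trans_eq (by rw [ih, h, add_zero])

theorem nsmul_inf_nsmul_eq_zero {x y : A} (h : x ⊓ y = 0) (m n : ℕ) : m • x ⊓ n • y = 0 := by
  rw [inf_comm]
  refine inf_nsmul_eq_zero ?_ m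
  rw [inf_comm, inf_nsmul_eq_zero h n]

theorem sub_inf_sub_eq_zero (x y : A) : (x - y) ⊓ (y - x) = 0 := by
  have add_sub_le_left : x ⊓ y + (x - y) ≤ x :=
    (add_le_add_right (tsub_le_tsub_left inf_le_right x) _).trans_eq
      (add_tsub_cancel_of_le inf_le_left)
  have add_sub_le_right : x ⊓ y + (y - x) ≤ y :=
    (add_le_add_right (tsub_le_tsub_left inf_le_left y) _).trans_eq
      (add_tsub_cancel_of_le inf_le_right)
  have add_inf_le : (x - y) ⊓ (y - x) + x ⊓ y ≤ x ⊓ y := by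
    rw [add_comm, add_inf_eq]
    exact inf_le_inf add_sub_le_left add_sub_le_right
  have le_compl_inf : (x - y) ⊓ (y - x) ≤ (x ⊓ y)ᶜ :=
    inf_le_left.trans ((sub_le_compl x y).trans (compl_anti inf_le_right))
  rw [← add_sub_cancel_of_le_compl le_compl_inf]
  exact tsub_eq_zero_of_le add_inf_le

end Arithmetic

section Product

variable {A : Type*} [MVAlgebra A] {a b c : A}

theorem prod_eq_sub (x y : A) : prod x y = x - yᶜ := rfl

theorem prod_comm (x y : A) : prod x y = prod y x := by rw [prod, prod, add_comm]

theorem prod_assoc (x y z : A) : prod (prod x y) z = prod x (prod y z) := by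
  simp only [prod, compl_compl', add_assoc]

theorem prod_le_left (x y : A) : prod x y ≤ x := tsub_le_self

theorem compl_prod (x y : A) : (prod x y)ᶜ = xᶜ + yᶜ := compl_compl' _

theorem compl_add (x y : A) : (x + y)ᶜ = prod xᶜ yᶜ := by
  rw [prod, compl_compl', compl_compl']

theorem add_prod_eq_prod_add (hab : a ≤ bᶜ) (hbc : b ≤ cᶜ) :
    prod (a + b) c = prod a (b + c) := by
  have hc : cᶜ = b + (cᶜ - b) := (add_tsub_cancel_of_le hbc).symm
  rw [prod_eq_sub, prod_eq_sub, hc, ← tsub_tsub, add_sub_cancel_of_le_compl hab, sub_def cᶜ b,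
    compl_compl', add_comm b c]

theorem add_prod_eq_add_prod (hab : a ≤ bᶜ) (hbc : cᶜ ≤ b) :
    prod (a + b) c = a + prod b c := by
  have hb : b = (b - cᶜ) + cᶜ := (tsub_add_cancel_of_le hbc).symm
  have hb_compl : bᶜ = cᶜᶜ - (b - cᶜ) := by
    rw [sub_def cᶜᶜ, compl_compl', add_comm, ← hb]
  have no_carry : a + (b - cᶜ) ≤ cᶜᶜ := by
    refine (add_le_add_left hab _).trans_eq ?_
    rw [hb_compl, tsub_add_cancel_of_le (sub_le_compl b cᶜ)]
  rw [prod_eq_sub, prod_eq_sub]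
  conv_lhs => rw [hb, ← add_assoc]
  exact add_sub_cancel_of_le_compl no_carry

theorem prod_add_eq_add_prod (hab : a + b = 0ᶜ) (hbc : b + c = 0ᶜ) :
    prod a b + c = a + prod b c := by
  have dual := add_prod_eq_prod_add (a := aᶜ) (b := bᶜ) (c := cᶜ)
    (by rwa [compl_compl', compl_le_iff_add_eq]) (by rwa [compl_compl', compl_le_iff_add_eq])
  rw [← compl_injective.eq_iff, compl_add, compl_add, compl_prod, compl_prod, dual]

end Product

end MVAlgebra

/-- Homomorphisms of MV-algebras. -/
structure MVHom (A B : Type*) [MVAlgebra A] [MVAlgebra B] extends A →+ B where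
  map_compl' : ∀ a, toFun aᶜ = (toFun a)ᶜ

namespace MVHom

open MVAlgebra

variable {A B : Type*} [MVAlgebra A] [MVAlgebra B]

instance : FunLike (MVHom A B) A B where
  coe f := f.toAddMonoidHom
  coe_injective f g h := by
    cases f; cases g
    congr
    exact DFunLike.coe_injective h

instance : AddMonoidHomClass (MVHom A B) A B where
  map_add f := f.map_add'
  map_zero f := f.map_zero'

variable (f : MVHom A B)

theorem map_compl (a : A) : f aᶜ = (f a)ᶜ := f.map_compl' a

theorem map_compl_zero : f 0ᶜ = 0ᶜ := by rw [map_compl, map_zero]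

theorem map_sub (a b : A) : f (a - b) = f a - f b := by
  rw [sub_def, map_compl, map_add, map_compl, ← sub_def]

theorem map_prod (a b : A) : f (prod a b) = prod (f a) (f b) := by
  rw [prod_eq_sub, map_sub, map_compl, ← prod_eq_sub]

theorem monotone : Monotone f := fun a b h => by
  rw [le_iff, ← map_compl, ← map_add, le_iff.1 h, map_compl_zero]

/-- Composition of homomorphisms. -/
def comp {C : Type*} [MVAlgebra C] (g : MVHom B C) (f : MVHom A B) : MVHom A C where
  toAddMonoidHom := g.toAddMonoidHom.comp f.toAddMonoidHom
  map_compl' a := (congrArg g (map_compl f a)).trans (map_compl g (f a))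

variable {f}

theorem injective_of_forall_eq_zero (hf : ∀ a, f a = 0 → a = 0) : Function.Injective f := by
  have le_of_eq {a b : A} (h : f a = f b) : a ≤ b :=
    tsub_eq_zero_iff_le.1 (hf _ (by rw [map_sub, h, tsub_self]))
  exact fun a b h => le_antisymm (le_of_eq h) (le_of_eq h.symm)

theorem map_ne_compl_zero (hf : Function.Injective f) {a : A} (ha : a ≠ 0ᶜ) : f a ≠ 0ᶜ :=
  fun h => ha (hf (h.trans (map_compl_zero f).symm))

/-- The homomorphism into a power whose coordinates are given homomorphisms. -/
def pi {ι : Type*} (f : ι → MVHom A B) : MVHom A (ι → B) where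
  toFun a i := f i a
  map_zero' := funext fun i => map_zero (f i)
  map_add' a b := funext fun i => map_add (f i) a b
  map_compl' a := funext fun i => map_compl (f i) a

end MVHom

/-- The Chang group of a totally ordered MV-algebra `A`: the totally ordered group whose unit
interval is `A`. The pair `(m, a)` with `a ≠ 1` stands for the sum of `m` units and of `a`. -/
@[ext]
structure ChangGroup (A : Type*) [MVAlgebra A] where
  int : ℤ
  frac : A
  frac_ne : frac ≠ 0ᶜ

namespace ChangGroup

open MVAlgebra

section Group

variable {A : Type*} [MVChain A]

theorem le_compl_of_add_ne {a b : A} (h : a + b ≠ 0ᶜ) : a ≤ bᶜ := by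
  refine (MVChain.le_total' a bᶜ).resolve_right fun hba => h ?_
  rwa [add_comm, ← compl_le_iff_add_eq]

theorem prod_ne_compl_zero {a : A} (ha : a ≠ 0ᶜ) (b : A) : prod a b ≠ 0ᶜ := fun h =>
  ha (compl_zero_le_iff.1 (h ▸ prod_le_left a b))

open Classical in
noncomputable instance : Add (ChangGroup A) where
  add x y :=
    if h : x.frac + y.frac = 0ᶜ then
      ⟨x.int + y.int + 1, prod x.frac y.frac, prod_ne_compl_zero x.frac_ne _⟩
    else ⟨x.int + y.int, x.frac + y.frac, h⟩

theorem add_of_eq {x y : ChangGroup A} (h : x.frac + y.frac = 0ᶜ) :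
    x + y = ⟨x.int + y.int + 1, prod x.frac y.frac, prod_ne_compl_zero x.frac_ne _⟩ := dif_pos h

theorem add_of_ne {x y : ChangGroup A} (h : x.frac + y.frac ≠ 0ᶜ) :
    x + y = ⟨x.int + y.int, x.frac + y.frac, h⟩ := dif_neg h

protected theorem add_comm (x y : ChangGroup A) : x + y = y + x := by
  by_cases h : x.frac + y.frac = 0ᶜ
  · rw [add_of_eq h, add_of_eq (by rwa [add_comm])]
    ext
    · simp only [add_comm]
    · exact prod_comm _ _
  · rw [add_of_ne h, add_of_ne (by rwa [add_comm])]
    ext <;> simp only [add_comm]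

theorem add_assoc_of_ne {x y z : ChangGroup A} (hxy : x.frac + y.frac ≠ 0ᶜ) :
    x + y + z = x + (y + z) := by
  rw [add_of_ne hxy]
  by_cases hyz : y.frac + z.frac = 0ᶜ
  · have h : x.frac + y.frac + z.frac = 0ᶜ := by rw [add_assoc, hyz, add_one']
    have h_frac : prod (x.frac + y.frac) z.frac = x.frac + prod y.frac z.frac :=
      add_prod_eq_add_prod (le_compl_of_add_ne hxy) (compl_le_iff_add_eq.2 (by rwa [add_comm]))
    rw [add_of_eq hyz, add_of_eq h, add_of_ne (h_frac ▸ prod_ne_compl_zero hxy _)]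
    ext
    · simp only [add_assoc]
    · exact h_frac
  · rw [add_of_ne hyz]
    by_cases h : x.frac + y.frac + z.frac = 0ᶜ
    · rw [add_of_eq h, add_of_eq (by rwa [← add_assoc])]
      ext
      · simp only [add_assoc]
      · exact add_prod_eq_prod_add (le_compl_of_add_ne hxy) (le_compl_of_add_ne hyz)
    · rw [add_of_ne h, add_of_ne (by rwa [← add_assoc])]
      ext <;> simp only [add_assoc]

theorem add_assoc_of_eq {x y z : ChangGroup A} (hxy : x.frac + y.frac = 0ᶜ)
    (hyz : y.frac + z.frac = 0ᶜ) : x + y + z = x + (y + z) := by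
  have h_frac := prod_add_eq_add_prod hxy hyz
  rw [add_of_eq hxy, add_of_eq hyz]
  by_cases h : prod x.frac y.frac + z.frac = 0ᶜ
  · rw [add_of_eq h, add_of_eq (h_frac ▸ h)]
    ext
    · dsimp only; ring
    · exact prod_assoc _ _ _
  · rw [add_of_ne h, add_of_ne (h_frac ▸ h)]
    ext
    · dsimp only; ring
    · exact h_frac

protected theorem add_assoc (x y z : ChangGroup A) : x + y + z = x + (y + z) := by
  by_cases hxy : x.frac + y.frac = 0ᶜ
  · by_cases hyz : y.frac + z.frac = 0ᶜ
    · exact add_assoc_of_eq hxy hyz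
    · rw [ChangGroup.add_comm x (y + z), ChangGroup.add_comm y z,
        add_assoc_of_ne (x := z) (by rwa [add_comm]), ChangGroup.add_comm y x,
        ChangGroup.add_comm z]
  · exact add_assoc_of_ne hxy

theorem int_add_int_le (x y : ChangGroup A) : x.int + y.int ≤ (x + y).int := by
  by_cases h : x.frac + y.frac = 0ᶜ
  · rw [add_of_eq h]; exact (lt_add_one _).le
  · rw [add_of_ne h]

variable [Nontrivial A]

instance : Zero (ChangGroup A) := ⟨⟨0, 0, zero_ne_compl_zero⟩⟩

open Classical in
noncomputable instance : Neg (ChangGroup A) where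
  neg x :=
    if h : x.frac = 0 then ⟨-x.int, 0, zero_ne_compl_zero⟩
    else ⟨-x.int - 1, x.fracᶜ, compl_injective.ne h⟩

theorem neg_of_eq {x : ChangGroup A} (h : x.frac = 0) :
    -x = ⟨-x.int, 0, zero_ne_compl_zero⟩ := dif_pos h

theorem neg_of_ne {x : ChangGroup A} (h : x.frac ≠ 0) :
    -x = ⟨-x.int - 1, x.fracᶜ, compl_injective.ne h⟩ := dif_neg h

protected theorem zero_add (x : ChangGroup A) : 0 + x = x := by
  have h_frac : (0 : ChangGroup A).frac + x.frac = x.frac := zero_add _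
  rw [add_of_ne (h_frac.symm ▸ x.frac_ne)]
  ext
  · exact zero_add _
  · exact h_frac

protected theorem neg_add_cancel (x : ChangGroup A) : -x + x = 0 := by
  by_cases h : x.frac = 0
  · have h_frac : (0 : A) + x.frac = 0 := by rw [h, add_zero]
    rw [neg_of_eq h, add_of_ne (ne_of_eq_of_ne h_frac zero_ne_compl_zero)]
    ext
    · exact neg_add_cancel _
    · exact h_frac
  · rw [neg_of_ne h, add_of_eq (compl_add_self _)]
    ext
    · change -x.int - 1 + x.int + 1 = 0
      ring
    · change (x.fracᶜᶜ + x.fracᶜ)ᶜ = 0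
      rw [compl_add_self, compl_compl']

noncomputable instance : AddCommGroup (ChangGroup A) where
  add_assoc := ChangGroup.add_assoc
  zero_add := ChangGroup.zero_add
  add_zero x := by rw [ChangGroup.add_comm, ChangGroup.zero_add]
  neg_add_cancel := ChangGroup.neg_add_cancel
  add_comm := ChangGroup.add_comm
  nsmul := nsmulRec
  zsmul := zsmulRec

/-- The positive cone of the Chang group: the pairs `(m, a)` with `0 ≤ m`. -/
def cone (A : Type*) [MVChain A] [Nontrivial A] : AddGroupCone (ChangGroup A) where
  carrier := {x | 0 ≤ x.int}
  zero_mem' := le_refl (0 : ℤ)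
  add_mem' {x y} hx hy := (add_nonneg hx hy).trans (int_add_int_le x y)
  eq_zero_of_mem_of_neg_mem' {x} (hx : 0 ≤ x.int) (hx_neg : 0 ≤ (-x).int) := by
    by_cases h : x.frac = 0
    · rw [neg_of_eq h] at hx_neg
      exact ChangGroup.ext (le_antisymm (neg_nonneg.1 hx_neg) hx) h
    · rw [neg_of_ne h] at hx_neg
      dsimp only at hx_neg
      lia

theorem mem_cone {x : ChangGroup A} : x ∈ cone A ↔ 0 ≤ x.int := Iff.rfl

instance : HasMemOrNegMem (cone A) where
  mem_or_neg_mem x := by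
    refine or_iff_not_imp_left.2 fun hx => ?_
    rw [mem_cone] at hx ⊢
    by_cases h : x.frac = 0
    · rw [neg_of_eq h]; dsimp only; lia
    · rw [neg_of_ne h]; dsimp only; lia

open Classical in
noncomputable instance : LinearOrder (ChangGroup A) := LinearOrder.mkOfAddGroupCone (cone A)

instance : IsOrderedAddMonoid (ChangGroup A) := IsOrderedAddMonoid.mkOfCone (cone A)

theorem nonneg_iff {x : ChangGroup A} : 0 ≤ x ↔ 0 ≤ x.int := by
  change x - 0 ∈ cone A ↔ _
  rw [sub_zero, mem_cone]

end Group

section Embedding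

variable {A : Type*} [MVChain A] [Nontrivial A]

/-- The strong unit `(1, 0)` of the Chang group. -/
def unit (A : Type*) [MVChain A] [Nontrivial A] : ChangGroup A := ⟨1, 0, zero_ne_compl_zero⟩

open Classical in
/-- The inclusion of a totally ordered MV-algebra into its Chang group. The top element is sent to
the unit because `(0, 1)` is not an admissible pair. -/
noncomputable def of (a : A) : ChangGroup A := if h : a = 0ᶜ then unit A else ⟨0, a, h⟩

theorem of_compl_zero : of (0ᶜ : A) = unit A := dif_pos rfl

theorem of_of_ne {a : A} (h : a ≠ 0ᶜ) : of a = ⟨0, a, h⟩ := dif_neg h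

theorem of_zero : of (0 : A) = 0 := of_of_ne zero_ne_compl_zero

theorem of_injective : Function.Injective (of : A → ChangGroup A) := by
  intro a b h
  by_cases ha : a = 0ᶜ <;> by_cases hb : b = 0ᶜ
  · rw [ha, hb]
  · rw [ha, of_compl_zero, of_of_ne hb] at h
    exact absurd (congrArg int h) one_ne_zero
  · rw [hb, of_compl_zero, of_of_ne ha] at h
    exact absurd (congrArg int h) zero_ne_one
  · rw [of_of_ne ha, of_of_ne hb] at h
    exact congrArg frac h

theorem of_nonneg (a : A) : 0 ≤ of a := by
  rw [nonneg_iff]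
  by_cases ha : a = 0ᶜ
  · rw [ha, of_compl_zero]; exact zero_le_one
  · rw [of_of_ne ha]

theorem of_add_of_ne {a b : A} (h : a + b ≠ 0ᶜ) : of (a + b) = of a + of b := by
  have ha : a ≠ 0ᶜ := by rintro rfl; exact h (by rw [add_comm, add_one'])
  have hb : b ≠ 0ᶜ := by rintro rfl; exact h (add_one' a)
  rw [of_of_ne h, of_of_ne ha, of_of_ne hb]
  exact (add_of_ne (x := ⟨0, a, ha⟩) (y := ⟨0, b, hb⟩) h).symm

theorem of_add_of_eq {a b : A} (ha : a ≠ 0ᶜ) (hb : b ≠ 0ᶜ) (h : a + b = 0ᶜ) :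
    of a + of b = unit A + of (prod a b) := by
  have no_carry : (unit A).frac + prod a b ≠ 0ᶜ := by
    rw [show (unit A).frac = 0 from rfl, zero_add]; exact prod_ne_compl_zero ha b
  rw [of_of_ne ha, of_of_ne hb, of_of_ne (prod_ne_compl_zero ha b),
    add_of_eq (x := ⟨0, a, ha⟩) (y := ⟨0, b, hb⟩) h, add_of_ne no_carry]
  ext
  · rfl
  · exact (zero_add _).symm

theorem unit_le_of_add_of {a b : A} (h : a + b = 0ᶜ) : unit A ≤ of a + of b := by
  by_cases ha : a = 0ᶜ
  · rw [ha, of_compl_zero]; exact le_add_of_nonneg_right (of_nonneg b)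
  by_cases hb : b = 0ᶜ
  · rw [hb, of_compl_zero]; exact le_add_of_nonneg_left (of_nonneg a)
  rw [of_add_of_eq ha hb h]
  exact le_add_of_nonneg_right (of_nonneg _)

theorem of_compl (a : A) : of aᶜ = unit A - of a := by
  rw [eq_sub_iff_add_eq]
  by_cases ha : a = 0ᶜ
  · rw [ha, of_compl_zero, compl_compl', of_zero, zero_add]
  by_cases ha₀ : a = 0
  · rw [ha₀, of_compl_zero, of_zero, add_zero]
  have prod_eq : prod aᶜ a = 0 := by rw [prod, compl_add_self, compl_compl']
  rw [of_add_of_eq (compl_injective.ne ha₀) ha (compl_add_self a), prod_eq, of_zero, add_zero]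

theorem of_le_unit (a : A) : of a ≤ unit A := by
  rw [← sub_nonneg, ← of_compl]
  exact of_nonneg _

theorem of_add (a b : A) : of (a + b) = min (unit A) (of a + of b) := by
  by_cases h : a + b = 0ᶜ
  · rw [min_eq_left (unit_le_of_add_of h), h, of_compl_zero]
  · rw [← of_add_of_ne h, min_eq_right (of_le_unit _)]

end Embedding

section Map

variable {A B : Type*} [MVChain A] [MVChain B] [Nontrivial A] [Nontrivial B] {f : MVHom A B}
  (hf : Function.Injective f)

/-- The homomorphism of Chang groups induced by an injective homomorphism of MV-chains. Injectivity
keeps the second entries different from `1`. -/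
noncomputable def map : ChangGroup A →+ ChangGroup B :=
  AddMonoidHom.mk' (fun x => ⟨x.int, f x.frac, MVHom.map_ne_compl_zero hf x.frac_ne⟩) fun x y => by
    by_cases h : x.frac + y.frac = 0ᶜ
    · rw [add_of_eq h, add_of_eq (by rw [← map_add, h, MVHom.map_compl_zero])]
      ext
      · rfl
      · exact f.map_prod _ _
    · rw [add_of_ne h, add_of_ne (by rw [← map_add]; exact MVHom.map_ne_compl_zero hf h)]
      ext
      · rfl
      · exact map_add f _ _

theorem map_of (a : A) : map hf (of a) = of (f a) := by
  by_cases h : a = 0ᶜ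
  · rw [h, f.map_compl_zero, of_compl_zero, of_compl_zero]
    ext
    · rfl
    · exact map_zero f
  · rw [of_of_ne h, of_of_ne (MVHom.map_ne_compl_zero hf h)]
    rfl

theorem map_unit : map hf (unit A) = unit B := by
  rw [← of_compl_zero, map_of, f.map_compl_zero, of_compl_zero]

theorem map_strictMono : StrictMono (map hf) := by
  refine Monotone.strictMono_of_injective (fun x y h => ?_) fun x y h => ?_
  · rw [← sub_nonneg, ← map_sub, nonneg_iff]
    exact (nonneg_iff (x := y - x)).1 (sub_nonneg.2 h)
  · have h_int : x.int = y.int := congrArg (fun z : ChangGroup B => z.int) h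
    have h_frac : f x.frac = f y.frac := congrArg (fun z : ChangGroup B => z.frac) h
    exact ChangGroup.ext h_int (hf h_frac)

end Map

end ChangGroup

/-- The unit interval `[0, u]` of a totally ordered abelian group. -/
@[ext]
structure UnitInterval (G : Type*) [AddCommGroup G] [LinearOrder G] (u : G) where
  val : G
  nonneg : 0 ≤ val
  le : val ≤ u

namespace UnitInterval

variable {G : Type*} [AddCommGroup G] [LinearOrder G] {u : G}

instance [Fact (0 ≤ u)] : Zero (UnitInterval G u) := ⟨⟨0, le_rfl, Fact.out⟩⟩

theorem val_zero [Fact (0 ≤ u)] : (0 : UnitInterval G u).val = 0 := rfl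

variable [IsOrderedAddMonoid G]

instance : Add (UnitInterval G u) where
  add x y := ⟨min u (x.val + y.val), le_min (x.nonneg.trans x.le) (add_nonneg x.nonneg y.nonneg),
    min_le_left _ _⟩

instance : Compl (UnitInterval G u) where
  compl x := ⟨u - x.val, sub_nonneg.2 x.le, sub_le_self _ x.nonneg⟩

theorem val_add (x y : UnitInterval G u) : (x + y).val = min u (x.val + y.val) := rfl

theorem val_compl (x : UnitInterval G u) : xᶜ.val = u - x.val := rfl

theorem val_sup (x y : UnitInterval G u) : ((xᶜ + y)ᶜ + y).val = max x.val y.val := by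
  simp only [val_add, val_compl]
  rcases le_total x.val y.val with h | h
  · have h_unit : u ≤ u - x.val + y.val := by
      rw [sub_add]; exact (le_sub_self_iff u).2 (sub_nonpos.2 h)
    rw [min_eq_left h_unit, sub_self, zero_add, min_eq_right y.le, max_eq_right h]
  · have h_unit : u - x.val + y.val ≤ u := by rw [sub_add]; exact sub_le_self _ (sub_nonneg.2 h)
    rw [min_eq_right h_unit, max_eq_left h, sub_add, add_sub_cancel_right, sub_sub_cancel,
      min_eq_right x.le]

protected theorem add_comm (x y : UnitInterval G u) : x + y = y + x := by
  ext
  rw [val_add, val_add, add_comm]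

theorem val_add_add (x y z : UnitInterval G u) :
    (x + y + z).val = min u (x.val + y.val + z.val) := by
  rw [val_add, val_add, ← min_add_add_right, ← min_assoc,
    min_eq_left (le_add_of_nonneg_right z.nonneg)]

theorem val_compl_add_eq {x y : UnitInterval G u} (h : x.val ≤ y.val) : (xᶜ + y).val = u := by
  rw [val_add, val_compl, sub_add]
  exact min_eq_left ((le_sub_self_iff u).2 (sub_nonpos.2 h))

variable [Fact (0 ≤ u)]

theorem val_compl_zero : (0ᶜ : UnitInterval G u).val = u := sub_zero u

protected theorem zero_add (x : UnitInterval G u) : 0 + x = x := by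
  ext
  rw [val_add, val_zero, zero_add, min_eq_right x.le]

instance : MVChain (UnitInterval G u) where
  add_assoc x y z := by
    rw [UnitInterval.add_comm x (y + z)]
    ext
    rw [val_add_add, val_add_add, add_assoc, add_comm x.val]
  zero_add := UnitInterval.zero_add
  add_zero x := by rw [UnitInterval.add_comm, UnitInterval.zero_add]
  add_comm := UnitInterval.add_comm
  nsmul := nsmulRec
  compl_compl' x := by
    ext
    rw [val_compl, val_compl, sub_sub_cancel]
  add_one' x := by
    ext
    rw [val_add, val_compl_zero, min_eq_left (le_add_of_nonneg_left x.nonneg)]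
  sup_comm' x y := by
    ext
    rw [val_sup, val_sup, max_comm]
  le_total' x y := by
    refine (le_total x.val y.val).imp (fun h => ?_) fun h => ?_ <;>
      exact UnitInterval.ext ((val_compl_add_eq h).trans val_compl_zero.symm)

/-- The homomorphism from `A` to the unit interval of `G` given by a homomorphism from the Chang
group of `A` to `G`. -/
noncomputable def lift {A : Type*} [MVChain A] [Nontrivial A] {w : ChangGroup A →+ G}
    (hw : Monotone w) (hu : w (ChangGroup.unit A) = u) : MVHom A (UnitInterval G u) where
  toFun a := ⟨w (ChangGroup.of a), (map_zero w).ge.trans (hw (ChangGroup.of_nonneg a)),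
    (hw (ChangGroup.of_le_unit a)).trans_eq hu⟩
  map_zero' := by
    ext
    exact (congrArg w ChangGroup.of_zero).trans (map_zero w)
  map_add' a b := by
    ext
    change w (ChangGroup.of (a + b)) = min u (w (ChangGroup.of a) + w (ChangGroup.of b))
    rw [ChangGroup.of_add, hw.map_min, map_add, hu]
  map_compl' a := by
    ext
    change w (ChangGroup.of aᶜ) = u - w (ChangGroup.of a)
    rw [ChangGroup.of_compl, map_sub, hu]

theorem lift_injective {A : Type*} [MVChain A] [Nontrivial A] {w : ChangGroup A →+ G}
    (hw : StrictMono w) (hu : w (ChangGroup.unit A) = u) :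
    Function.Injective (lift hw.monotone hu) := fun _ _ h =>
  ChangGroup.of_injective (hw.injective (congrArg val h))

end UnitInterval

section OrderedGroup

section SpanningSubmonoid

variable {M : Type*}

theorem nsmul_mem_of_ne_zero [AddMonoid M] {N : AddSubsemigroup M} {x : M} {n : ℕ} (hn : n ≠ 0)
    (hx : x ∈ N) : n • x ∈ N := by
  induction n, Nat.one_le_iff_ne_zero.2 hn using Nat.le_induction with
  | base => rwa [one_nsmul]
  | succ n one_le ih =>
    rw [succ_nsmul]
    exact N.add_mem (ih (Nat.one_le_iff_ne_zero.1 one_le)) hx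

theorem exists_add_nsmul_mem_of_maximal_disjoint [AddCommMonoid M] {N : AddSubsemigroup M}
    {P : AddSubmonoid M} (hP : Maximal (fun Q : AddSubmonoid M => Disjoint (Q : Set M) N) P) {x : M}
    (hx : x ∉ P) : ∃ p ∈ P, ∃ n : ℕ, n ≠ 0 ∧ p + n • x ∈ N := by
  have not_disjoint : ¬ Disjoint ((P ⊔ AddSubmonoid.multiples x : AddSubmonoid M) : Set M) N :=
    fun h => hx (hP.le_of_ge h le_sup_left (AddSubmonoid.mem_sup_right
      (AddSubmonoid.mem_multiples x)))
  obtain ⟨y, hy, hyN⟩ := Set.not_disjoint_iff.1 not_disjoint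
  obtain ⟨p, hp, _, ⟨n, rfl⟩, rfl⟩ := AddSubmonoid.mem_sup.1 hy
  refine ⟨p, hp, n, ?_, hyN⟩
  rintro rfl
  refine Set.disjoint_left.1 hP.prop hp ?_
  rwa [← add_zero p, ← zero_nsmul x]

theorem isSpanning_of_maximal_disjoint [AddCommGroup M] {N : AddSubsemigroup M}
    {P : AddSubmonoid M} (hP : Maximal (fun Q : AddSubmonoid M => Disjoint (Q : Set M) N) P) :
    P.IsSpanning := by
  intro x
  by_contra! hx
  obtain ⟨p, hp, n, hn, hpn⟩ := exists_add_nsmul_mem_of_maximal_disjoint hP hx.1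
  obtain ⟨q, hq, m, hm, hqm⟩ := exists_add_nsmul_mem_of_maximal_disjoint hP hx.2
  have cancel : m • (p + n • x) + n • (q + m • -x) = m • p + n • q := by
    rw [smul_add, smul_add, smul_neg, smul_neg, smul_smul, smul_smul, mul_comm m n]
    abel
  refine Set.disjoint_left.1 hP.prop (P.add_mem (P.nsmul_mem hp m) (P.nsmul_mem hq n)) ?_
  rw [← cancel]
  exact N.add_mem (nsmul_mem_of_ne_zero hm hpn) (nsmul_mem_of_ne_zero hn hqm)

theorem exists_isSpanning_of_disjoint [AddCommGroup M] {P₀ : AddSubmonoid M}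
    {N : AddSubsemigroup M} (h : Disjoint (P₀ : Set M) N) :
    ∃ P : AddSubmonoid M, P₀ ≤ P ∧ Disjoint (P : Set M) N ∧ P.IsSpanning := by
  obtain ⟨P, hP₀, hP⟩ := zorn_le_nonempty₀ {P : AddSubmonoid M | Disjoint (P : Set M) N}
    (fun c hc hchain P hPc => by
      refine ⟨sSup c, Set.disjoint_left.2 fun x hx => ?_, fun Q hQ => le_sSup hQ⟩
      obtain ⟨Q, hQ, hxQ⟩ :=
        (AddSubmonoid.mem_sSup_of_directedOn ⟨P, hPc⟩ hchain.directedOn).1 hx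
      exact Set.disjoint_left.1 (hc hQ) hxQ) P₀ h
  exact ⟨P, hP₀, hP.prop, isSpanning_of_maximal_disjoint hP⟩

end SpanningSubmonoid

section SupportQuotient

variable {M : Type*} [AddCommGroup M] (P : AddSubmonoid M)

theorem mk_mem_map_support_iff {x : M} :
    (x : M ⧸ P.support) ∈ P.map (QuotientAddGroup.mk' P.support) ↔ x ∈ P := by
  refine ⟨?_, fun hx => ⟨x, hx, rfl⟩⟩
  rintro ⟨y, hy, hyx⟩
  have hx : y + (-y + x) ∈ P := P.add_mem hy (QuotientAddGroup.eq.1 hyx).1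
  rwa [add_neg_cancel_left] at hx

/-- The image of a submonoid `P` in the quotient by its units `P ∩ -P`. Passing to this quotient
turns a spanning submonoid of a group into the positive cone of a total order. -/
def supportQuotientCone : AddGroupCone (M ⧸ P.support) where
  toAddSubmonoid := P.map (QuotientAddGroup.mk' P.support)
  eq_zero_of_mem_of_neg_mem' {a} := by
    induction a using QuotientAddGroup.induction_on with
    | H x =>
      intro hx hx_neg
      rw [QuotientAddGroup.eq_zero_iff]
      exact ⟨(mk_mem_map_support_iff P).1 hx, (mk_mem_map_support_iff P (x := -x)).1 hx_neg⟩

variable {P}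

theorem mk_mem_supportQuotientCone {x : M} :
    (x : M ⧸ P.support) ∈ supportQuotientCone P ↔ x ∈ P :=
  mk_mem_map_support_iff P

theorem hasMemOrNegMem_supportQuotientCone (hP : P.IsSpanning) :
    HasMemOrNegMem (supportQuotientCone P) where
  mem_or_neg_mem a := by
    induction a using QuotientAddGroup.induction_on with
    | H x =>
      exact (hP x).imp mk_mem_supportQuotientCone.2 (mk_mem_supportQuotientCone (x := -x)).2

end SupportQuotient

theorem exists_hom_nonneg_iff_of_isSpanning {M : Type u} [AddCommGroup M] {P : AddSubmonoid M}
    (hP : P.IsSpanning) :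
    ∃ (V : Type u) (_ : AddCommGroup V) (_ : LinearOrder V) (_ : IsOrderedAddMonoid V)
      (π : M →+ V), ∀ x, 0 ≤ π x ↔ x ∈ P := by
  classical
  have := hasMemOrNegMem_supportQuotientCone hP
  let _ : LinearOrder (M ⧸ P.support) := LinearOrder.mkOfAddGroupCone (supportQuotientCone P)
  refine ⟨M ⧸ P.support, inferInstance, inferInstance,
    IsOrderedAddMonoid.mkOfCone (supportQuotientCone P), QuotientAddGroup.mk' _, fun x => ?_⟩
  change (x : M ⧸ P.support) - 0 ∈ supportQuotientCone P ↔ x ∈ P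
  rw [sub_zero, mk_mem_supportQuotientCone]

theorem exists_strictMono_hom_of_forall_not_pos {M : Type u} [AddCommGroup M] [PartialOrder M]
    [IsOrderedAddMonoid M] {H : AddSubgroup M} (hH : ∀ h ∈ H, ¬ 0 < h) :
    ∃ (V : Type u) (_ : AddCommGroup V) (_ : LinearOrder V) (_ : IsOrderedAddMonoid V)
      (π : M →+ V), StrictMono π ∧ ∀ h ∈ H, π h = 0 := by
  let above : AddSubmonoid M :=
    { carrier := {g | ∃ h ∈ H, h ≤ g}
      zero_mem' := ⟨0, H.zero_mem, le_rfl⟩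
      add_mem' := fun ⟨h, hh, hg⟩ ⟨h', hh', hg'⟩ => ⟨h + h', H.add_mem hh hh', add_le_add hg hg'⟩ }
  let below : AddSubsemigroup M :=
    { carrier := {g | ∃ h ∈ H, g < h}
      add_mem' := fun ⟨h, hh, hg⟩ ⟨h', hh', hg'⟩ => ⟨h + h', H.add_mem hh hh', add_lt_add hg hg'⟩ }
  have disjoint_below : Disjoint (above : Set M) below :=
    Set.disjoint_left.2 fun g ⟨h, hh, hhg⟩ ⟨h', hh', hgh'⟩ =>
      hH _ (H.sub_mem hh' hh) (sub_pos.2 (hhg.trans_lt hgh'))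
  obtain ⟨P, hP, hP_below, hP_span⟩ := exists_isSpanning_of_disjoint disjoint_below
  obtain ⟨V, _, _, _, π, hπ⟩ := exists_hom_nonneg_iff_of_isSpanning hP_span
  have nonneg_of_mem : ∀ h ∈ H, 0 ≤ π h := fun h hh => (hπ h).2 (hP ⟨h, hh, le_rfl⟩)
  refine ⟨V, _, _, ‹_›, π, fun x y hxy => ?_, fun h hh => le_antisymm ?_ (nonneg_of_mem h hh)⟩
  · have sub_mem_below : x - y ∈ below := ⟨0, H.zero_mem, sub_neg.2 hxy⟩
    have not_nonneg : ¬ 0 ≤ π (x - y) := fun h =>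
      Set.disjoint_left.1 hP_below ((hπ _).1 h) sub_mem_below
    rwa [map_sub, sub_nonneg, not_le] at not_nonneg
  · rw [← neg_nonneg, ← map_neg]
    exact nonneg_of_mem _ (H.neg_mem hh)

section Amalgamation

variable {ι : Type*} [Fintype ι] {C : Type*} [AddCommGroup C] {G : ι → Type*}
  [∀ i, AddCommGroup (G i)]

/-- The subgroup by which the product of the groups `G i` is divided in order to identify the
images of `C` under the homomorphisms `f i`. -/
def amalgamKer (f : ∀ i, C →+ G i) : AddSubgroup (∀ i, G i) :=
  (∑ i, Pi.evalAddMonoidHom (fun _ : ι => C) i).ker.map (AddMonoidHom.piMap f)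

theorem mem_amalgamKer {f : ∀ i, C →+ G i} {g : ∀ i, G i} :
    g ∈ amalgamKer f ↔ ∃ c : ι → C, ∑ i, c i = 0 ∧ (fun i => f i (c i)) = g := by
  simp only [amalgamKer, AddSubgroup.mem_map, AddMonoidHom.mem_ker, AddMonoidHom.finsetSum_apply,
    Pi.evalAddMonoidHom_apply]
  rfl

theorem single_sub_single_mem_amalgamKer [DecidableEq ι] (f : ∀ i, C →+ G i) (i j : ι) (c : C) :
    Pi.single i (f i c) - Pi.single j (f j c) ∈ amalgamKer f := by
  refine mem_amalgamKer.2 ⟨Pi.single i c - Pi.single j c, by simp, funext fun l => ?_⟩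
  rw [Pi.sub_apply, map_sub, Pi.sub_apply, Pi.apply_single (fun i => f i) fun i => map_zero (f i),
    Pi.apply_single (fun i => f i) fun i => map_zero (f i)]

theorem not_pos_of_mem_amalgamKer [LinearOrder C] [IsOrderedAddMonoid C]
    [∀ i, PartialOrder (G i)] {f : ∀ i, C →+ G i} (hf : ∀ i, StrictMono (f i)) {g : ∀ i, G i}
    (hg : g ∈ amalgamKer f) : ¬ 0 < g := by
  obtain ⟨c, hc, rfl⟩ := mem_amalgamKer.1 hg
  intro hpos
  obtain ⟨hle, i, hlt⟩ := Pi.lt_def.1 hpos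
  have hc_pos : 0 < c := Pi.lt_def.2
    ⟨fun j => (hf j).le_iff_le.1 ((map_zero (f j)).trans_le (hle j)), i,
      (hf i).lt_iff_lt.1 ((map_zero (f i)).trans_lt hlt)⟩
  exact (Fintype.sum_pos hc_pos).ne' hc

end Amalgamation

theorem exists_orderedGroup_amalgam {ι : Type v} [Finite ι] {C : Type*} [AddCommGroup C]
    [LinearOrder C] [IsOrderedAddMonoid C] {G : ι → Type u} [∀ i, AddCommGroup (G i)]
    [∀ i, PartialOrder (G i)] [∀ i, IsOrderedAddMonoid (G i)] {f : ∀ i, C →+ G i}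
    (hf : ∀ i, StrictMono (f i)) :
    ∃ (V : Type max u v) (_ : AddCommGroup V) (_ : LinearOrder V) (_ : IsOrderedAddMonoid V)
      (e : ∀ i, G i →+ V), (∀ i, StrictMono (e i)) ∧ ∀ i j c, e i (f i c) = e j (f j c) := by
  classical
  have := Fintype.ofFinite ι
  obtain ⟨V, _, _, _, π, hπ, hπ_ker⟩ :=
    exists_strictMono_hom_of_forall_not_pos fun _ => not_pos_of_mem_amalgamKer hf
  refine ⟨V, _, _, ‹_›, fun i => π.comp (AddMonoidHom.single G i),
    fun i => hπ.comp (Pi.single_strictMono i), fun i j c => ?_⟩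
  have hker := hπ_ker _ (single_sub_single_mem_amalgamKer f i j c)
  rwa [map_sub, sub_eq_zero] at hker

end OrderedGroup

open MVAlgebra in
theorem exists_mvChain_amalgam {ι : Type v} [Finite ι] [Nonempty ι] {C : Type*} [MVChain C]
    [Nontrivial C] {B : ι → Type u} [∀ i, MVChain (B i)] {f : ∀ i, MVHom C (B i)}
    (hf : ∀ i, Function.Injective (f i)) :
    ∃ (V : Type max u v) (_ : MVChain V) (e : ∀ i, MVHom (B i) V),
      (∀ i, Function.Injective (e i)) ∧ ∀ i j c, e i (f i c) = e j (f j c) := by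
  have := fun i => (hf i).nontrivial
  obtain ⟨V, _, _, _, w, hw, hw_comp⟩ :=
    exists_orderedGroup_amalgam fun i => ChangGroup.map_strictMono (hf i)
  obtain ⟨i₀⟩ := ‹Nonempty ι›
  have map_unit_eq : ∀ i, w i (ChangGroup.unit (B i)) = w i₀ (ChangGroup.unit (B i₀)) := fun i => by
    rw [← ChangGroup.map_unit (hf i), hw_comp i i₀, ChangGroup.map_unit]
  have : Fact (0 ≤ w i₀ (ChangGroup.unit (B i₀))) :=
    ⟨(map_zero (w i₀)).ge.trans ((hw i₀).monotone (ChangGroup.nonneg_iff.2 zero_le_one))⟩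
  refine ⟨UnitInterval V (w i₀ (ChangGroup.unit (B i₀))), inferInstance,
    fun i => UnitInterval.lift (hw i).monotone (map_unit_eq i),
    fun i => UnitInterval.lift_injective (hw i) (map_unit_eq i), fun i j c => ?_⟩
  ext
  change w i (ChangGroup.of (f i c)) = w j (ChangGroup.of (f j c))
  rw [← ChangGroup.map_of (hf i), ← ChangGroup.map_of (hf j), hw_comp]

namespace MVAlgebra

section Ideal

variable {A : Type*} [MVAlgebra A] {I J : AddSubmonoid A} {x y : A}

/-- The congruence of an MV-algebra determined by an ideal. Ideals are encoded as the additive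
submonoids that are lower sets; the construction makes sense for every additive submonoid. -/
def idealCon (I : AddSubmonoid A) : AddCon A where
  r x y := ∃ e ∈ I, x ≤ y + e ∧ y ≤ x + e
  iseqv :=
    { refl := fun x => ⟨0, I.zero_mem, le_self_add, le_self_add⟩
      symm := fun ⟨e, he, hxy, hyx⟩ => ⟨e, he, hyx, hxy⟩
      trans := fun {x y z} ⟨e, he, hxy, hyx⟩ ⟨d, hd, hyz, hzy⟩ => ⟨d + e, I.add_mem hd he,
        (hxy.trans (add_le_add_left hyz e)).trans_eq (add_assoc z d e),
        (hzy.trans (add_le_add_left hyx d)).trans_eq (by rw [add_assoc, add_comm e])⟩ }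
  add' := fun {x y z w} ⟨e, he, hxy, hyx⟩ ⟨d, hd, hzw, hwz⟩ => ⟨e + d, I.add_mem he hd,
    (add_le_add hxy hzw).trans_eq (add_add_add_comm y e w d),
    (add_le_add hyx hwz).trans_eq (add_add_add_comm x e z d)⟩

theorem idealCon_iff : idealCon I x y ↔ ∃ e ∈ I, x ≤ y + e ∧ y ≤ x + e := Iff.rfl

theorem idealCon_compl (h : idealCon I x y) : idealCon I xᶜ yᶜ := by
  obtain ⟨e, he, hxy, hyx⟩ := idealCon_iff.1 h
  exact idealCon_iff.2 ⟨e, he, compl_le_compl_add_iff.2 hyx, compl_le_compl_add_iff.2 hxy⟩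

theorem eq_of_idealCon_of_idealCon (hIJ : ∀ e ∈ I, ∀ d ∈ J, e ⊓ d = 0) (hI : idealCon I x y)
    (hJ : idealCon J x y) : x = y := by
  obtain ⟨e, he, hxy, hyx⟩ := idealCon_iff.1 hI
  obtain ⟨d, hd, hxy', hyx'⟩ := idealCon_iff.1 hJ
  have add_inf_eq_self (z : A) : (z + e) ⊓ (z + d) = z := by
    rw [← add_inf_eq, hIJ e he d hd, add_zero]
  exact le_antisymm ((le_inf hxy hxy').trans_eq (add_inf_eq_self y))
    ((le_inf hyx hyx').trans_eq (add_inf_eq_self x))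

instance (I : AddSubmonoid A) : MVAlgebra (idealCon I).Quotient where
  compl := Quotient.map compl fun _ _ h => idealCon_compl h
  compl_compl' x := by
    induction x using AddCon.induction_on with
    | H x => exact congrArg (AddCon.toQuotient (c := idealCon I)) (compl_compl' x)
  add_one' x := by
    induction x using AddCon.induction_on with
    | H x => exact congrArg (AddCon.toQuotient (c := idealCon I)) (add_one' x)
  sup_comm' x y := by
    induction x, y using AddCon.induction_on₂ with
    | H x y => exact congrArg (AddCon.toQuotient (c := idealCon I)) (sup_comm' x y)

/-- The quotient homomorphism by an ideal. -/
def mkQuotient (I : AddSubmonoid A) : MVHom A (idealCon I).Quotient where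
  toAddMonoidHom := (idealCon I).mk'
  map_compl' _ := rfl

theorem mkQuotient_eq_zero_iff (hI : IsLowerSet (I : Set A)) : mkQuotient I x = 0 ↔ x ∈ I := by
  refine (AddCon.eq (idealCon I)).trans ⟨fun ⟨e, he, hx, _⟩ => ?_, fun hx => ?_⟩
  · exact hI (hx.trans_eq (zero_add e)) he
  · exact ⟨x, hx, le_add_self, zero_le⟩

/-- Prime ideals, in the sense that the quotient is totally ordered. The improper ideal is
allowed. -/
def IsPrime (I : AddSubmonoid A) : Prop := ∀ x y, x - y ∈ I ∨ y - x ∈ I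

/-- The quotient by a prime ideal, as a totally ordered MV-algebra. -/
@[reducible]
def IsPrime.quotientChain (hI : IsPrime I) : MVChain (idealCon I).Quotient where
  le_total' x y := by
    have mkQuotient_le {x y : A} (h : x - y ∈ I) : mkQuotient I x ≤ mkQuotient I y := by
      rw [← tsub_eq_zero_iff_le, ← MVHom.map_sub]
      exact (AddCon.eq (idealCon I)).2 ⟨x - y, h, le_add_self, zero_le⟩
    induction x, y using AddCon.induction_on₂ with
    | H x y => exact (hI x y).imp mkQuotient_le mkQuotient_le

theorem IsPrime.mem_or_mem_of_inf_mem (hprime : IsPrime I) (hI : IsLowerSet (I : Set A))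
    (h : x ⊓ y ∈ I) : x ∈ I ∨ y ∈ I :=
  (hprime x y).imp (fun hxy => hI (le_inf_add_sub x y) (I.add_mem h hxy))
    fun hyx => hI (le_inf_add_sub y x) (I.add_mem (inf_comm x y ▸ h) hyx)

/-- The ideal generated by an additive submonoid. -/
def idealClosure (J : AddSubmonoid A) : AddSubmonoid A where
  carrier := lowerClosure (J : Set A)
  zero_mem' := subset_lowerClosure J.zero_mem
  add_mem' := fun ⟨e, he, hx⟩ ⟨d, hd, hy⟩ => ⟨e + d, J.add_mem he hd, add_le_add hx hy⟩

theorem mem_idealClosure : x ∈ idealClosure J ↔ ∃ e ∈ J, x ≤ e := Iff.rfl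

theorem isLowerSet_idealClosure (J : AddSubmonoid A) : IsLowerSet (idealClosure J : Set A) :=
  (lowerClosure (J : Set A)).lower

theorem le_idealClosure (J : AddSubmonoid A) : J ≤ idealClosure J := subset_lowerClosure

theorem exists_pairwise_disjoint_notMem {ι : Type*} [Finite ι] {I : ι → AddSubmonoid A}
    (hlower : ∀ i, IsLowerSet (I i : Set A)) (hprime : ∀ i, IsPrime (I i))
    (hproper : ∀ i, 0ᶜ ∉ I i) (hincomparable : Pairwise fun i j => ¬ I i ≤ I j) :
    ∃ y : ι → A, (∀ i, y i ∉ I i) ∧ Pairwise fun i j => y i ⊓ y j = 0 := by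
  classical
  have := Fintype.ofFinite ι
  have exists_separator (i j) : ∃ a, i ≠ j → a ∈ I i ∧ a ∉ I j := by
    by_cases h : i = j
    · exact ⟨0, fun hij => absurd h hij⟩
    · obtain ⟨a, ha⟩ := SetLike.not_le_iff_exists.1 (hincomparable h)
      exact ⟨a, fun _ => ha⟩
  choose a ha using exists_separator
  refine ⟨fun i => (Finset.univ.filter (i ≠ ·)).inf fun j => a j i - a i j, fun i => ?_,
    fun i j hij => ?_⟩
  · refine Finset.inf_induction (p := (· ∉ I i)) (hproper i) (fun x hx y hy hxy => ?_)
      fun j hj hmem => ?_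
    · exact ((hprime i).mem_or_mem_of_inf_mem (hlower i) hxy).elim hx hy
    · have hij := (Finset.mem_filter.1 hj).2
      exact (ha j i hij.symm).2 (hlower i le_add_tsub ((I i).add_mem (ha i j hij).1 hmem))
  · refine nonpos_iff_eq_zero.1 (le_of_le_of_eq ?_ (sub_inf_sub_eq_zero (a j i) (a i j)))
    exact inf_le_inf (Finset.inf_le (Finset.mem_filter.2 ⟨Finset.mem_univ j, hij⟩))
      (Finset.inf_le (Finset.mem_filter.2 ⟨Finset.mem_univ i, hij.symm⟩))

end Ideal

end MVAlgebra

namespace MonadicMVAlgebra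

open MVAlgebra

section Constants

variable {A : Type*} [MonadicMVAlgebra A] {x y c d : A}

theorem all_le (x : A) : all x ≤ x := m1 x

theorem all_compl_zero : all (0ᶜ : A) = 0ᶜ := by
  have h := m3 (0 : A) 0
  rwa [show imp (all (0 : A)) 0 = 0ᶜ from all_le 0,
    show imp (all (0 : A)) (all 0) = 0ᶜ from compl_add_self (all 0)] at h

theorem all_zero : all (0 : A) = 0 := nonpos_iff_eq_zero.1 (all_le 0)

theorem ex_eq (x : A) : ex x = (all xᶜ)ᶜ := by
  have h := m2 x 0
  simp only [all_zero, imp, add_zero] at h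
  rw [h, compl_compl']

theorem le_ex (x : A) : x ≤ ex x := by
  rw [ex_eq, ← compl_compl' x]
  exact compl_anti ((all_le _).trans_eq (by rw [compl_compl']))

theorem all_all (x : A) : all (all x) = all x := by
  have h := m2 0ᶜ x
  rwa [ex_eq, compl_compl', all_zero, imp, compl_compl', zero_add] at h

theorem all_mono (h : x ≤ y) : all x ≤ all y := by
  have himp := m3 x y
  rw [show imp (all x) y = 0ᶜ from (all_le x).trans h, all_compl_zero] at himp
  exact himp.symm

theorem all_eq_zero_of_le (h : x ≤ y) (hy : all y = 0) : all x = 0 :=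
  nonpos_iff_eq_zero.1 ((all_mono h).trans_eq hy)

theorem all_imp_of_all_eq (hx : all x = x) (hy : all y = y) : all (imp x y) = imp x y := by
  have h := m3 x y
  rwa [hx, hy] at h

theorem all_compl_of_all_eq (hx : all x = x) : all xᶜ = xᶜ := by
  have h := all_imp_of_all_eq hx all_zero
  rwa [imp, add_zero] at h

variable (A) in
/-- The subalgebra of constants: the elements fixed by `∀`, equivalently by `∃`. -/
def constants : AddSubmonoid A where
  carrier := {x | all x = x}
  zero_mem' := all_zero
  add_mem' hx hy := by
    have h := all_imp_of_all_eq (all_compl_of_all_eq hx) hy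
    rwa [imp, compl_compl'] at h

theorem mem_constants : c ∈ constants A ↔ all c = c := Iff.rfl

theorem all_mem_constants (x : A) : all x ∈ constants A := all_all x

theorem compl_mem_constants (hc : c ∈ constants A) : cᶜ ∈ constants A := all_compl_of_all_eq hc

theorem sub_mem_constants (hc : c ∈ constants A) (hd : d ∈ constants A) : c - d ∈ constants A :=
  compl_mem_constants ((constants A).add_mem (compl_mem_constants hc) hd)

theorem ex_mem_constants (x : A) : ex x ∈ constants A := by
  rw [ex_eq]
  exact compl_mem_constants (all_mem_constants _)

theorem all_add_of_mem_constants (x : A) (hc : c ∈ constants A) : all (x + c) = all x + c := by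
  have h := m3 cᶜ x
  rwa [mem_constants.1 (compl_mem_constants hc), imp, imp, compl_compl', add_comm,
    add_comm c] at h

theorem all_add_self (x : A) : all (x + x) = all x + all x := by
  have h := m5 xᶜ
  simp only [prod, ex_eq, compl_compl'] at h
  exact compl_injective h

theorem all_nsmul_eq_zero (hx : all x = 0) (n : ℕ) : all (n • x) = 0 := by
  have all_two_pow_nsmul (m : ℕ) : all (2 ^ m • x) = 0 := by
    induction m with
    | zero => rwa [pow_zero, one_nsmul]
    | succ m ih => rw [pow_succ, mul_two, add_nsmul, all_add_self, ih, add_zero]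
  exact all_eq_zero_of_le (nsmul_le_nsmul_left zero_le Nat.lt_two_pow_self.le)
    (all_two_pow_nsmul n)

theorem all_sub_all (x : A) : all (x - all x) = 0 := by
  have all_eq : all x = all (x - all x) + all x := by
    rw [← all_add_of_mem_constants _ (all_mem_constants x), tsub_add_cancel_of_le (all_le x)]
  have le_compl_all : all (x - all x) ≤ (all x)ᶜ := (all_le _).trans (sub_le_compl x (all x))
  rw [← add_sub_cancel_of_le_compl le_compl_all, ← all_eq, tsub_self]

instance : MVAlgebra (constants A) where
  compl x := ⟨xᶜ, compl_mem_constants x.2⟩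
  compl_compl' x := Subtype.ext (compl_compl' x.1)
  add_one' x := Subtype.ext (add_one' x.1)
  sup_comm' x y := Subtype.ext (sup_comm' x.1 y.1)

variable (A) in
/-- The inclusion of the subalgebra of constants. -/
def constantsInclusion : MVHom (constants A) A where
  toAddMonoidHom := (constants A).subtype
  map_compl' _ := rfl

/-- The congruence of a monadic MV-algebra determined by an additive submonoid of constants. -/
def constCongruence (I : AddSubmonoid A) (hI : I ≤ constants A) : MonadicMVCongruence A :=
  have idealCon_all {x y : A} (h : idealCon I x y) : idealCon I (all x) (all y) := by
    obtain ⟨e, he, hxy, hyx⟩ := idealCon_iff.1 h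
    refine idealCon_iff.2 ⟨e, he, ?_, ?_⟩ <;> rw [← all_add_of_mem_constants _ (hI he)]
    exacts [all_mono hxy, all_mono hyx]
  { (idealCon I).toSetoid with
    add' := (idealCon I).add'
    compl' := idealCon_compl
    ex' := fun h => by
      rw [ex_eq, ex_eq]
      exact idealCon_compl (idealCon_all (idealCon_compl h))
    all' := idealCon_all }

theorem eq_zero_of_constCongruence_trivial {I : AddSubmonoid A} {hI : I ≤ constants A}
    (h : ∀ x y, (constCongruence I hI).r x y → x = y) (hc : c ∈ I) : c = 0 :=
  h c 0 (idealCon_iff.2 ⟨c, hc, le_add_self, zero_le⟩)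

theorem IsFSI.le_total_of_mem_constants (h : IsFSI A) (hc : c ∈ constants A)
    (hd : d ∈ constants A) : c ≤ d ∨ d ≤ c := by
  have multiples_le {x y : A} (hx : x ∈ constants A) (hy : y ∈ constants A) :
      AddSubmonoid.multiples (x - y) ≤ constants A :=
    AddSubmonoid.multiples_le.2 (sub_mem_constants hx hy)
  have orthogonal : ∀ e ∈ AddSubmonoid.multiples (c - d), ∀ e' ∈ AddSubmonoid.multiples (d - c),
      e ⊓ e' = 0 := by
    rintro _ ⟨m, rfl⟩ _ ⟨n, rfl⟩
    exact nsmul_inf_nsmul_eq_zero (sub_inf_sub_eq_zero c d) m n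
  refine (h (constCongruence _ (multiples_le hc hd)) (constCongruence _ (multiples_le hd hc))
    fun _ _ hab => eq_of_idealCon_of_idealCon orthogonal hab.1 hab.2).imp (fun htriv => ?_)
    fun htriv => ?_ <;>
  exact tsub_eq_zero_iff_le.1
    (eq_zero_of_constCongruence_trivial htriv (AddSubmonoid.mem_multiples _))

theorem IsFSI.exists_eq_zero_of_pairwise_disjoint (h : IsFSI A) {k : ℕ} (hW : SatisfiesW A k)
    {y : Fin (k + 1) → A} (hy : Pairwise fun i j => y i ⊓ y j = 0) : ∃ i, y i = 0 := by
  have premise : (0ᶜ : A) ≤ (Finset.univ.filter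
      fun p : Fin (k + 1) × Fin (k + 1) => p.1 < p.2).inf fun p => all ((y p.1)ᶜ ⊔ (y p.2)ᶜ) := by
    refine Finset.le_inf fun p hp => ?_
    have compl_inf : (y p.1)ᶜ ⊔ (y p.2)ᶜ = (y p.1 ⊓ y p.2)ᶜ := (compl_compl' _).symm
    rw [compl_inf, hy (Finset.mem_filter.1 hp).2.ne, all_compl_zero]
  have sup_eq : (0ᶜ : A) ≤ Finset.univ.sup fun i => all (y i)ᶜ :=
    premise.trans (hW fun i => (y i)ᶜ)
  have directed : Directed (· ≤ ·) fun i => all (y i)ᶜ := fun i j =>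
    (h.le_total_of_mem_constants (all_mem_constants (y i)ᶜ) (all_mem_constants (y j)ᶜ)).elim
      (fun hij => ⟨j, hij, le_rfl⟩) fun hji => ⟨i, le_rfl, hji⟩
  obtain ⟨i, hi⟩ := directed.finite_le id
  exact ⟨i, compl_injective (compl_zero_le_iff.1
    (sup_eq.trans ((Finset.sup_le fun j _ => hi j).trans (all_le _))))⟩

end Constants

section NullIdeal

variable {A : Type*} [MonadicMVAlgebra A] {I M : AddSubmonoid A} {a x : A}

/-- Null ideals: the ideals on which `∀` vanishes, that is, which contain no nonzero constant. -/
structure IsNullIdeal (I : AddSubmonoid A) : Prop where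
  isLowerSet : IsLowerSet (I : Set A)
  all_eq_zero : ∀ a ∈ I, all a = 0

theorem IsNullIdeal.eq_zero_of_mem_constants (hI : IsNullIdeal I) (hx : x ∈ constants A)
    (hxI : x ∈ I) : x = 0 :=
  (mem_constants.1 hx).symm.trans (hI.all_eq_zero x hxI)

theorem IsNullIdeal.compl_zero_notMem [Nontrivial A] (hI : IsNullIdeal I) : 0ᶜ ∉ I := fun h =>
  zero_ne_compl_zero (hI.eq_zero_of_mem_constants all_compl_zero h).symm

theorem isNullIdeal_idealClosure (h : ∀ e ∈ I, all e = 0) : IsNullIdeal (idealClosure I) where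
  isLowerSet := isLowerSet_idealClosure I
  all_eq_zero a ha := by
    obtain ⟨e, he, hae⟩ := mem_idealClosure.1 ha
    exact all_eq_zero_of_le hae (h e he)

theorem IsNullIdeal.exists_le_maximal (hI : IsNullIdeal I) :
    ∃ M, I ≤ M ∧ Maximal IsNullIdeal M := by
  refine zorn_le_nonempty₀ {I : AddSubmonoid A | IsNullIdeal I} (fun c hc hchain P hP =>
    ⟨sSup c, ?_, fun Q hQ => le_sSup hQ⟩) I hI
  have mem_sSup (x : A) : x ∈ sSup c ↔ ∃ Q ∈ c, x ∈ Q :=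
    AddSubmonoid.mem_sSup_of_directedOn ⟨P, hP⟩ hchain.directedOn
  refine ⟨fun x y hyx hx => ?_, fun x hx => ?_⟩ <;> obtain ⟨Q, hQ, hxQ⟩ := (mem_sSup x).1 hx
  · exact (mem_sSup y).2 ⟨Q, hQ, (hc hQ).isLowerSet hyx hxQ⟩
  · exact (hc hQ).all_eq_zero x hxQ

theorem exists_maximal_isNullIdeal_mem (ha : all a = 0) : ∃ M, Maximal IsNullIdeal M ∧ a ∈ M := by
  have isNullIdeal_multiples : IsNullIdeal (idealClosure (AddSubmonoid.multiples a)) :=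
    isNullIdeal_idealClosure (by rintro _ ⟨n, rfl⟩; exact all_nsmul_eq_zero ha n)
  obtain ⟨M, hle, hM⟩ := isNullIdeal_multiples.exists_le_maximal
  exact ⟨M, hM, hle (le_idealClosure _ (AddSubmonoid.mem_multiples a))⟩

theorem exists_all_add_nsmul_ne_zero (hM : Maximal IsNullIdeal M) (hx : x ∉ M) :
    ∃ e ∈ M, ∃ n : ℕ, all (e + n • x) ≠ 0 := by
  by_contra! hnull
  have isNullIdeal_adjoin : IsNullIdeal (idealClosure (M ⊔ AddSubmonoid.multiples x)) := by
    refine isNullIdeal_idealClosure fun z hz => ?_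
    obtain ⟨e, he, _, ⟨n, rfl⟩, rfl⟩ := AddSubmonoid.mem_sup.1 hz
    exact hnull e he n
  exact hx (hM.le_of_ge isNullIdeal_adjoin (le_sup_left.trans (le_idealClosure _))
    (le_idealClosure _ (AddSubmonoid.mem_sup_right (AddSubmonoid.mem_multiples x))))

theorem IsFSI.isPrime_of_maximal (h : IsFSI A) (hM : Maximal IsNullIdeal M) : IsPrime M := by
  intro x y
  by_contra! hxy
  obtain ⟨e, he, m, hm⟩ := exists_all_add_nsmul_ne_zero hM hxy.1
  obtain ⟨d, hd, n, hn⟩ := exists_all_add_nsmul_ne_zero hM hxy.2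
  have eq_zero_of_le {c : A} (hc : c ∈ constants A) (hce : c ≤ e + m • (x - y))
      (hcd : c ≤ d + n • (y - x)) : c = 0 := by
    have inf_eq : (e + d + m • (x - y)) ⊓ (e + d + n • (y - x)) = e + d := by
      rw [← add_inf_eq, nsmul_inf_nsmul_eq_zero (sub_inf_sub_eq_zero x y), add_zero]
    refine hM.prop.eq_zero_of_mem_constants hc
      (hM.prop.isLowerSet ((le_inf ?_ ?_).trans_eq inf_eq) (M.add_mem he hd))
    · exact hce.trans (add_le_add_left le_self_add _)
    · exact hcd.trans (add_le_add_left le_add_self _)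
  rcases h.le_total_of_mem_constants (all_mem_constants (e + m • (x - y)))
    (all_mem_constants (d + n • (y - x))) with hle | hle
  · exact hm (eq_zero_of_le (all_mem_constants _) (all_le _) (hle.trans (all_le _)))
  · exact hn (eq_zero_of_le (all_mem_constants _) (hle.trans (all_le _)) (all_le _))

theorem IsFSI.not_injective_maximal [Nontrivial A] (h : IsFSI A) {k : ℕ} (hW : SatisfiesW A k)
    (M : Fin (k + 1) → {M : AddSubmonoid A // Maximal IsNullIdeal M}) :
    ¬ Function.Injective M := by
  intro hinj
  have incomparable : Pairwise fun i j => ¬ (M i).1 ≤ (M j).1 := fun i j hij hle =>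
    hij (hinj (Subtype.ext ((M i).2.eq_of_le (M j).2.prop hle)))
  obtain ⟨y, hy_notMem, hy_disjoint⟩ := exists_pairwise_disjoint_notMem
    (fun i => (M i).2.prop.isLowerSet) (fun i => h.isPrime_of_maximal (M i).2)
    (fun i => (M i).2.prop.compl_zero_notMem) incomparable
  obtain ⟨i, hi⟩ := h.exists_eq_zero_of_pairwise_disjoint hW hy_disjoint
  exact hy_notMem i (hi ▸ (M i).1.zero_mem)

theorem IsNullIdeal.le_total_of_mem_constants {c d : A} (hI : IsNullIdeal I) (hprime : IsPrime I)
    (hc : c ∈ constants A) (hd : d ∈ constants A) : c ≤ d ∨ d ≤ c :=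
  (hprime c d).imp
    (fun h => tsub_eq_zero_iff_le.1 (hI.eq_zero_of_mem_constants (sub_mem_constants hc hd) h))
    fun h => tsub_eq_zero_iff_le.1 (hI.eq_zero_of_mem_constants (sub_mem_constants hd hc) h)

end NullIdeal

section Embedding

theorem exists_homs_of_isNullIdeal {A : Type u} [MonadicMVAlgebra A] [Nontrivial A] {ι : Type v}
    [Finite ι] [Nonempty ι] {I : ι → AddSubmonoid A} (hnull : ∀ i, IsNullIdeal (I i))
    (hprime : ∀ i, IsPrime (I i)) :
    ∃ (V : Type max u v) (_ : MVChain V) (f : ι → MVHom A V),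
      (∀ i a, f i a = 0 ↔ a ∈ I i) ∧ ∀ i j, ∀ c ∈ constants A, f i c = f j c := by
  obtain ⟨i₀⟩ := ‹Nonempty ι›
  let _ : MVChain (constants A) :=
    ⟨fun c d => ((hnull i₀).le_total_of_mem_constants (hprime i₀) c.2 d.2).imp
      Subtype.ext Subtype.ext⟩
  let _ (i) : MVChain (idealCon (I i)).Quotient := (hprime i).quotientChain
  have : Nontrivial (constants A) :=
    ⟨0, 0ᶜ, fun h => zero_ne_compl_zero (congrArg (constantsInclusion A) h)⟩
  have injective_on_constants (i) :
      Function.Injective ((mkQuotient (I i)).comp (constantsInclusion A)) :=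
    MVHom.injective_of_forall_eq_zero fun c hc => Subtype.ext
      ((hnull i).eq_zero_of_mem_constants c.2
        ((mkQuotient_eq_zero_iff (hnull i).isLowerSet).1 hc))
  obtain ⟨V, _, e, he, he_comp⟩ := exists_mvChain_amalgam injective_on_constants
  refine ⟨V, _, fun i => (e i).comp (mkQuotient (I i)), fun i a => ?_,
    fun i j c hc => he_comp i j ⟨c, hc⟩⟩
  rw [← mkQuotient_eq_zero_iff (hnull i).isLowerSet]
  exact map_eq_zero_iff (e i) (he i)

variable {A B : Type*} [MonadicMVAlgebra A] [MonadicMVAlgebra B]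

/-- The embedding given by a homomorphism that preserves `∀` and kills no nonzero constant. -/
def embeddingOfMVHom (f : MVHom A B) (hall : ∀ a, f (all a) = all (f a))
    (hconst : ∀ c ∈ constants A, f c = 0 → c = 0) : MonadicMVEmbedding A B :=
  have map_ex (a : A) : f (ex a) = ex (f a) := by
    rw [ex_eq, ex_eq, MVHom.map_compl, hall, MVHom.map_compl]
  { toFun := f
    injective' := MVHom.injective_of_forall_eq_zero fun a ha => by
      have ex_eq_zero : ex a = 0 := hconst _ (ex_mem_constants a)
        (by rw [map_ex, ha, ex_eq, all_compl_zero, compl_compl'])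
      exact nonpos_iff_eq_zero.1 ((le_ex a).trans_eq ex_eq_zero)
    map_zero' := map_zero f
    map_add' := map_add f
    map_compl' := MVHom.map_compl f
    map_ex' := map_ex
    map_all' := hall }

theorem pi_apply_all {ι V : Type*} [Fintype ι] [MVChain V] {f : ι → MVHom A V}
    (hconst : ∀ i j, ∀ c ∈ constants A, f i c = f j c) (hnull : ∀ a, all a = 0 → ∃ i, f i a = 0)
    (a : A) : MVHom.pi f (all a) = all (MVHom.pi f a) := by
  obtain ⟨j, hj⟩ := hnull _ (all_sub_all a)
  have map_le : f j a ≤ f j (all a) := by rwa [← tsub_eq_zero_iff_le, ← MVHom.map_sub]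
  have isMin (l) : f j a ≤ f l a :=
    map_le.trans_eq (hconst j l _ (all_mem_constants a)) |>.trans ((f l).monotone (all_le a))
  funext i
  calc f i (all a) = f j (all a) := hconst i j _ (all_mem_constants a)
    _ = f j a := le_antisymm ((f j).monotone (all_le a)) map_le
    _ = forallInf (MVHom.pi f a) i := (forallInf_eq (f := MVHom.pi f a) isMin i).symm

end Embedding

end MonadicMVAlgebra

theorem exists_surjective_of_forall_not_injective {X : Type*} [Nonempty X] {k : ℕ}
    (h : ∀ f : Fin (k + 1) → X, ¬ Function.Injective f) :
    ∃ g : Fin k → X, Function.Surjective g := by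
  have finite : Finite X := by
    by_contra hX
    rw [not_finite_iff_infinite] at hX
    exact h _ ((Infinite.natEmbedding X).injective.comp Fin.val_injective)
  have card_le : Nat.card X ≤ k := by
    by_contra! hX
    exact h _ ((Finite.equivFin X).symm.injective.comp (Fin.castLE_injective hX))
  exact ⟨_, Function.invFun_surjective
    ((Fin.castLE_injective card_le).comp (Finite.equivFin X).injective)⟩

theorem exists_embedding_power_of_subsingleton (A : Type*) [MonadicMVAlgebra A] [Subsingleton A]
    (X : Type*) [Fintype X] :
    ∃ _ : MVChain A, Nonempty (MonadicMVEmbedding A (X → A)) := by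
  let _ : MVChain A := ⟨fun x y => Or.inl (Subsingleton.elim x y).le⟩
  exact ⟨inferInstance, ⟨{
    toFun := 0
    injective' := Function.injective_of_subsingleton _
    map_zero' := rfl
    map_add' := fun _ _ => Subsingleton.elim _ _
    map_compl' := fun _ => Subsingleton.elim _ _
    map_ex' := fun _ => Subsingleton.elim _ _
    map_all' := fun _ => Subsingleton.elim _ _ }⟩⟩

open MonadicMVAlgebra in
theorem mainTheorem8_general (A : Type u) [MonadicMVAlgebra A] (k : ℕ) (hFSI : IsFSI A)
    (hW : SatisfiesW A k) :
    ∃ (V : Type u) (_ : MVChain V), Nonempty (MonadicMVEmbedding A (Fin k → V)) := by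
  rcases subsingleton_or_nontrivial A with _ | _
  · exact ⟨A, exists_embedding_power_of_subsingleton A (Fin k)⟩
  obtain ⟨M₀, hM₀, -⟩ := exists_maximal_isNullIdeal_mem (all_zero (A := A))
  have : Nonempty {M : AddSubmonoid A // Maximal IsNullIdeal M} := ⟨⟨M₀, hM₀⟩⟩
  obtain ⟨M, hM⟩ := exists_surjective_of_forall_not_injective (hFSI.not_injective_maximal hW)
  have := hM.nonempty
  obtain ⟨V, _, f, hf, hf_const⟩ := exists_homs_of_isNullIdeal (fun i => (M i).2.prop)
    fun i => hFSI.isPrime_of_maximal (M i).2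
  have exists_apply_eq_zero (a : A) (ha : all a = 0) : ∃ i, f i a = 0 := by
    obtain ⟨N, hN, haN⟩ := exists_maximal_isNullIdeal_mem ha
    obtain ⟨i, hi⟩ := hM ⟨N, hN⟩
    exact ⟨i, (hf i a).2 (by rwa [hi])⟩
  refine ⟨V, _, ⟨embeddingOfMVHom (MVHom.pi f) (pi_apply_all hf_const exists_apply_eq_zero)
    fun c hc hzero => ?_⟩⟩
  obtain ⟨i⟩ := ‹Nonempty (Fin k)›
  exact (M i).2.prop.eq_zero_of_mem_constants hc ((hf i c).1 (congrFun hzero i))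

theorem mainTheorem8 (A : Type u) [MonadicMVAlgebra A] (k : ℕ) (hk : 1 ≤ k)
    (hFSI : MonadicMVAlgebra.IsFSI A) (hwidth : MonadicMVAlgebra.HasWidth A k) :
    ∃ (V : Type u) (_ : MVChain V), Nonempty (MonadicMVEmbedding A (Fin k → V)) :=
  mainTheorem8_general A k hFSI hwidth.1
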